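/- Let $T=\{3412,3421,2341\}$, let $S_n(T)$ be the set of permutations of $\{1,\dots,n\}$ that contain no pattern from $T$ (a permutation contains a pattern if it has a subsequence order-isomorphic to it), and let $F_T(x)=\sum_{n\ge 0}|S_n(T)|\,x^n$ be the generating function of the $T$-avoiders. Define \[ r=r(x)=\frac{(\sqrt5-1)\left(1-\sqrt{1-(3+\sqrt5)x+\tfrac12(3-\sqrt5)x^2}\right)-(1+\sqrt5)x}{4x}, \] where the square root is the formal power series with constant term $1$, and let $t=t(x)$ be the same expression with $\sqrt5$ replaced by $-\sqrt5$ throughout. Then $r$ and $t$ are nonzero formal power series over $\mathbb{R}$, both $v=r+1$ and $v=t+1$ satisfy \[ x^2v^4+x(1-3x)v^3+(x^2-1)v^2+(2-x)v-1=0, \] and, in the field of formal Laurent series over $\mathbb{R}$, $1+\frac1r+\frac1t-\frac1x\neq 0$ and \[ F_T(x)=1+\frac{1+rt}{1+\frac1r+\frac1t-\frac1x}. \] -/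

import Mathlib

open scoped PowerSeries LaurentSeries

namespace PatternAvoidance

/-- `π` contains the pattern `σ`: some subsequence of `π`, at increasing positions, is
order-isomorphic to `σ`. -/
def Contains {k n : ℕ} (π : Equiv.Perm (Fin n)) (σ : Equiv.Perm (Fin k)) : Prop :=
  ∃ f : Fin k ↪o Fin n, ∀ i j : Fin k, π (f i) < π (f j) ↔ σ i < σ j

/-- `S_n(T)`: the permutations of length `n` that contain no pattern of `T`. -/
def avoiders {k : ℕ} (T : Set (Equiv.Perm (Fin k))) (n : ℕ) : Set (Equiv.Perm (Fin n)) :=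
  {π | ∀ σ ∈ T, ¬ Contains π σ}

/-- `F_T(x) = ∑ |S_n(T)| xⁿ`, with real coefficients. -/
noncomputable def genFun {k : ℕ} (T : Set (Equiv.Perm (Fin k))) : ℝ⟦X⟧ :=
  PowerSeries.mk fun n => ((avoiders T n).ncard : ℝ)

/-- The pattern `3412`, in one-line notation with the letters `1,2,3,4` written `0,1,2,3`. -/
def p3412 : Equiv.Perm (Fin 4) :=
  ⟨![2, 3, 0, 1], ![2, 3, 0, 1], by decide, by decide⟩

/-- The pattern `3421`. -/
def p3421 : Equiv.Perm (Fin 4) :=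
  ⟨![2, 3, 1, 0], ![3, 2, 0, 1], by decide, by decide⟩

/-- The pattern `2341`. -/
def p2341 : Equiv.Perm (Fin 4) :=
  ⟨![1, 2, 3, 0], ![3, 0, 1, 2], by decide, by decide⟩

/-- The square root of a formal power series with constant term `1`, as the binomial series
`∑ (1/2 choose m) (f - 1)^m`. -/
noncomputable def sqrtSeries (f : ℝ⟦X⟧) : ℝ⟦X⟧ :=
  (PowerSeries.binomialSeries ℝ (1 / 2 : ℝ)).subst (f - 1)

theorem hasSubst_sub_one {f : ℝ⟦X⟧} (hf : PowerSeries.constantCoeff f = 1) :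
    PowerSeries.HasSubst (f - 1) :=
  PowerSeries.HasSubst.of_constantCoeff_zero' (by simp [hf])

theorem sqrtSeries_sq {f : ℝ⟦X⟧} (hf : PowerSeries.constantCoeff f = 1) :
    sqrtSeries f ^ 2 = f := by
  have h := hasSubst_sub_one hf
  have hb : PowerSeries.binomialSeries ℝ (1 / 2 : ℝ) * PowerSeries.binomialSeries ℝ (1 / 2 : ℝ)
      = 1 + PowerSeries.X := by
    rw [← PowerSeries.binomialSeries_add]
    have := PowerSeries.binomialSeries_nat (R := ℝ) (A := ℝ) 1
    norm_num at this ⊢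
    exact this
  have h1 : PowerSeries.subst (f - 1) (1 : ℝ⟦X⟧) = (1 : ℝ⟦X⟧) := by
    rw [← PowerSeries.coe_substAlgHom h, map_one]
  rw [pow_two, sqrtSeries, ← PowerSeries.subst_mul h, hb, PowerSeries.subst_add h,
    PowerSeries.subst_X h, h1]
  ring

theorem constantCoeff_sqrtSeries {f : ℝ⟦X⟧} (hf : PowerSeries.constantCoeff f = 1) :
    PowerSeries.constantCoeff (sqrtSeries f) = 1 := by
  have h := hasSubst_sub_one hf
  have hd : (PowerSeries.X : ℝ⟦X⟧) ∣ PowerSeries.binomialSeries ℝ (1 / 2 : ℝ) - 1 := by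
    rw [PowerSeries.X_dvd_iff]; simp
  obtain ⟨g, hg⟩ := hd
  rw [sub_eq_iff_eq_add] at hg
  have h1 : PowerSeries.subst (f - 1) (1 : ℝ⟦X⟧) = (1 : ℝ⟦X⟧) := by
    rw [← PowerSeries.coe_substAlgHom h, map_one]
  rw [sqrtSeries, hg, PowerSeries.subst_add h, PowerSeries.subst_mul h, PowerSeries.subst_X h, h1]
  simp [hf]

/-- `1 - (3 + s) x + (1/2) (3 - s) x²`. -/
noncomputable def radicand (s : ℝ) : ℝ⟦X⟧ :=
  1 - PowerSeries.C (3 + s) * PowerSeries.X + PowerSeries.C ((3 - s) / 2) * PowerSeries.X ^ 2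

/-- `((s - 1) (1 - √(1 - (3 + s) x + (1/2) (3 - s) x²)) - (1 + s) x) / (4 x)` in the field of
formal Laurent series; it is `r` for `s = √5` and `t` for `s = -√5`. -/
noncomputable def branch (s : ℝ) : ℝ⸨X⸩ :=
  ((PowerSeries.C (s - 1) * (1 - sqrtSeries (radicand s))
      - PowerSeries.C (1 + s) * PowerSeries.X : ℝ⟦X⟧) : ℝ⸨X⸩)
    / ((4 * PowerSeries.X : ℝ⟦X⟧) : ℝ⸨X⸩)

/-- The kernel `K(x,v) = x²v⁴ + x(1-3x)v³ + (x²-1)v² + (2-x)v - 1` at a power series `v`. -/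
noncomputable def kernel (v : ℝ⟦X⟧) : ℝ⟦X⟧ :=
  PowerSeries.X ^ 2 * v ^ 4 + PowerSeries.X * (1 - 3 * PowerSeries.X) * v ^ 3
    + (PowerSeries.X ^ 2 - 1) * v ^ 2 + (2 - PowerSeries.X) * v - 1

end PatternAvoidance

/-!
Let `a ≤ b` be the statistics `activeBound` and `ascentBound` of an avoider of length `n`.
Appending a last entry changes the pair `(p, d) = (b - a, n - b)` by a rule that depends on `(p, d)`
only, so the generating function `Φ w` of the avoiders weighted by `w p d` satisfies
`Φ w = w 0 0 + x Φ (childSum w)`.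

Over `ℚ(√5)` the kernel splits into two factors `x (1 + k r) (1 + r) - r`, one for each root `k` of
`k² = k + 1`. If `r` is a root of such a factor, then the weight
`(1 + x (1 + r) p) (1 + k r) ^ d` is an eigenvector of `x childSum` with eigenvalue `1`, up to an
affine function of `d`. The functional equation therefore becomes a linear relation between
`F = Φ 1` and `Φ d`. Eliminating `Φ d` between the relations for the two conjugate roots gives `F`.
-/

namespace PatternAvoidance

open Finset Equiv PowerSeries

section Patterns

variable {k n : ℕ} {π : Perm (Fin n)}

/-- The set `T = {3412, 3421, 2341}`. -/
abbrev patterns : Set (Perm (Fin 4)) := {p3412, p3421, p2341}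

theorem contains_iff_strictMono {σ : Perm (Fin k)} :
    Contains π σ ↔ ∃ f : Fin k → Fin n, StrictMono f ∧ StrictMono (π ∘ f ∘ σ.symm) := by
  constructor
  · rintro ⟨f, hf⟩
    exact ⟨f, f.strictMono, fun a b hab => (hf _ _).2 (by simpa using hab)⟩
  · rintro ⟨f, hf, hπ⟩
    exact ⟨OrderEmbedding.ofStrictMono f hf, fun i j => by
      simpa using hπ.lt_iff_lt (a := σ i) (b := σ j)⟩

theorem contains_iff_exists_four {σ : Perm (Fin 4)} :
    Contains π σ ↔ ∃ i j k l, i < j ∧ j < k ∧ k < l ∧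
      StrictMono (π ∘ ![i, j, k, l] ∘ σ.symm) := by
  rw [contains_iff_strictMono]
  constructor
  · rintro ⟨f, hf, hπ⟩
    have hf_eq : ![f 0, f 1, f 2, f 3] = f := by ext a; fin_cases a <;> rfl
    exact ⟨f 0, f 1, f 2, f 3, hf (by decide), hf (by decide), hf (by decide), by rwa [hf_eq]⟩
  · rintro ⟨i, j, k, l, hij, hjk, hkl, hπ⟩
    refine ⟨_, Fin.strictMono_iff_lt_succ.2 fun a => ?_, hπ⟩
    fin_cases a <;> assumption

theorem contains_p3412_iff :
    Contains π p3412 ↔ ∃ i j k l, i < j ∧ j < k ∧ k < l ∧ π k < π l ∧ π l < π i ∧ π i < π j := by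
  simp [contains_iff_exists_four, Fin.strictMono_iff_lt_succ, Fin.forall_fin_succ, p3412]

theorem contains_p3421_iff :
    Contains π p3421 ↔ ∃ i j k l, i < j ∧ j < k ∧ k < l ∧ π l < π k ∧ π k < π i ∧ π i < π j := by
  simp [contains_iff_exists_four, Fin.strictMono_iff_lt_succ, Fin.forall_fin_succ, p3421]

theorem contains_p2341_iff :
    Contains π p2341 ↔ ∃ i j k l, i < j ∧ j < k ∧ k < l ∧ π l < π i ∧ π i < π j ∧ π j < π k := by
  simp [contains_iff_exists_four, Fin.strictMono_iff_lt_succ, Fin.forall_fin_succ, p2341]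

theorem mem_avoiders_patterns_iff :
    π ∈ avoiders patterns n ↔ ∀ i j k l, i < j → j < k → k < l → π i < π j →
      (π j < π k ∨ π k < π i) → π i < π l := by
  simp only [avoiders, Set.mem_ofPred_eq, Set.mem_insert_iff, Set.mem_singleton_iff,
    forall_eq_or_imp, forall_eq, contains_p3412_iff, contains_p3421_iff, contains_p2341_iff]
  constructor
  · rintro ⟨h3412, h3421, h2341⟩ i j k l hij hjk hkl hπij hπk
    by_contra hπl
    have hli : π l < π i := lt_of_le_of_ne (not_lt.1 hπl) (π.injective.ne (by order))
    rcases hπk with hjk' | hki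
    · exact h2341 ⟨i, j, k, l, hij, hjk, hkl, hli, hπij, hjk'⟩
    · rcases lt_or_gt_of_ne (π.injective.ne hkl.ne) with hkl' | hlk
      · exact h3412 ⟨i, j, k, l, hij, hjk, hkl, hkl', hli, hπij⟩
      · exact h3421 ⟨i, j, k, l, hij, hjk, hkl, hlk, hki, hπij⟩
  · intro h
    refine ⟨?_, ?_, ?_⟩ <;> rintro ⟨i, j, k, l, hij, hjk, hkl, h₁, h₂, h₃⟩
    · exact h₂.not_gt (h i j k l hij hjk hkl h₃ (.inr (h₁.trans h₂)))
    · exact (h₁.trans h₂).not_gt (h i j k l hij hjk hkl h₃ (.inr h₂))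
    · exact h₁.not_gt (h i j k l hij hjk hkl h₂ (.inl h₃))

end Patterns

section Bounds

variable {n : ℕ} {π : Perm (Fin n)} {P : Fin n → Prop}

/-- The entry at position `i` is the first letter of an occurrence of `12`. -/
def Starts12 (π : Perm (Fin n)) (i : Fin n) : Prop :=
  ∃ j, i < j ∧ π i < π j

/-- The entry at position `i` is the first letter of an occurrence of `123` or `231`. A pattern of
`T` is such an occurrence followed by an entry below its first letter. -/
def Starts123Or231 (π : Perm (Fin n)) (i : Fin n) : Prop :=
  ∃ j k, i < j ∧ j < k ∧ π i < π j ∧ (π j < π k ∨ π k < π i)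

theorem Starts123Or231.starts12 {i : Fin n} : Starts123Or231 π i → Starts12 π i :=
  fun ⟨j, _, hij, _, hπ, _⟩ => ⟨j, hij, hπ⟩

open Classical in
/-- The least natural number exceeding all entries `π i` with `P i`. -/
noncomputable def entryBound (π : Perm (Fin n)) (P : Fin n → Prop) : ℕ :=
  ({i | P i} : Finset (Fin n)).sup fun i => (π i : ℕ) + 1

theorem entryBound_le_iff {c : ℕ} : entryBound π P ≤ c ↔ ∀ i, P i → (π i : ℕ) < c := by
  simp [entryBound]

theorem lt_entryBound {i : Fin n} (hi : P i) : (π i : ℕ) < entryBound π P :=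
  entryBound_le_iff.1 le_rfl i hi

theorem exists_of_entryBound_pos (hpos : 0 < entryBound π P) :
    ∃ i, P i ∧ (π i : ℕ) + 1 = entryBound π P := by
  by_contra! h
  have hle : entryBound π P ≤ entryBound π P - 1 := entryBound_le_iff.2 fun i hi => by
    have := lt_entryBound (π := π) hi
    have := h i hi
    omega
  omega

/-- The smallest entry that may be appended to an avoider of `T`. -/
noncomputable def activeBound (π : Perm (Fin n)) : ℕ := entryBound π (Starts123Or231 π)

/-- The least bound on the first letters of the occurrences of `12`. Together with `activeBound` it
determines the same two statistics after appending an entry. -/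
noncomputable def ascentBound (π : Perm (Fin n)) : ℕ := entryBound π (Starts12 π)

theorem Starts123Or231.lt_activeBound {i : Fin n} (hi : Starts123Or231 π i) :
    (π i : ℕ) < activeBound π :=
  lt_entryBound hi

theorem Starts12.lt_ascentBound {i : Fin n} (hi : Starts12 π i) : (π i : ℕ) < ascentBound π :=
  lt_entryBound hi

theorem exists_starts12_of_ascentBound_pos (hpos : 0 < ascentBound π) :
    ∃ i, Starts12 π i ∧ (π i : ℕ) + 1 = ascentBound π :=
  exists_of_entryBound_pos hpos

theorem activeBound_le_ascentBound : activeBound π ≤ ascentBound π :=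
  entryBound_le_iff.2 fun _ hi => hi.starts12.lt_ascentBound

theorem ascentBound_le : ascentBound π ≤ n :=
  entryBound_le_iff.2 fun i _ => (π i).isLt

theorem exists_isTop_apply_eq_ascentBound (hlt : activeBound π < ascentBound π) :
    ∃ l, IsTop l ∧ (π l : ℕ) = ascentBound π := by
  obtain ⟨i, ⟨j, hij, hπij⟩, hi⟩ := exists_starts12_of_ascentBound_pos (pos_of_gt hlt)
  have hi_start : ¬ Starts123Or231 π i := fun h => by
    have := h.lt_activeBound
    omega
  obtain ⟨n, rfl⟩ := Nat.exists_eq_succ_of_ne_zero (Fin.pos i).ne'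
  have hle : ∀ m, m ≤ Fin.last n := Fin.le_last
  have hlast_ge : π i < π (Fin.last n) := by
    by_contra hnot
    have hil : π (Fin.last n) ≠ π i := π.injective.ne (hij.trans_le (hle j)).ne'
    have hjl : j ≠ Fin.last n := by rintro rfl; exact hnot hπij
    exact hi_start ⟨j, Fin.last n, hij, (hle j).lt_of_ne hjl, hπij,
      .inr ((not_lt.1 hnot).lt_of_ne hil)⟩
  refine ⟨Fin.last n, hle, ?_⟩
  by_contra hne
  obtain ⟨m, hm⟩ := π.surjective ⟨ascentBound π, by omega⟩
  have hm_val : (π m : ℕ) = ascentBound π := by rw [hm]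
  have hml : m < Fin.last n := (hle m).lt_of_ne (by rintro rfl; exact hne hm_val)
  have hm_starts : Starts12 π m := ⟨Fin.last n, hml, by omega⟩
  exact hm_starts.lt_ascentBound.ne hm_val

end Bounds

section AppendEntry

variable {n : ℕ} {π : Perm (Fin n)} {h : Fin (n + 1)} {i j : Fin n}

/-- The permutation obtained from `π` by appending a last entry `h` and raising by one the entries
that are at least `h`. -/
def appendEntry (π : Perm (Fin n)) (h : Fin (n + 1)) : Perm (Fin (n + 1)) :=
  (finSuccEquiv' (Fin.last n)).trans ((optionCongr π).trans (finSuccEquiv' h).symm)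

@[simp] theorem appendEntry_last : appendEntry π h (Fin.last n) = h := by
  simp [appendEntry]

@[simp] theorem appendEntry_castSucc : appendEntry π h i.castSucc = h.succAbove (π i) := by
  rw [appendEntry, Equiv.trans_apply, ← Fin.succAbove_last_apply, finSuccEquiv'_succAbove]
  simp

theorem appendEntry_injective2 : Function.Injective2 (appendEntry (n := n)) := by
  intro π π' h h' heq
  obtain rfl : h = h' := by simpa using congr($heq (Fin.last n))
  refine ⟨Equiv.ext fun i => h.succAbove_right_injective ?_, rfl⟩
  simpa using congr($heq i.castSucc)

variable (n) in
/-- A permutation of length `n + 1` splits into its last entry and the standardization of the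
rest. -/
noncomputable def appendEntryEquiv : Perm (Fin n) × Fin (n + 1) ≃ Perm (Fin (n + 1)) :=
  Equiv.ofBijective (Function.uncurry appendEntry)
    ((Fintype.bijective_iff_injective_and_card _).2
      ⟨appendEntry_injective2.uncurry, by simp [Fintype.card_perm, Nat.factorial_succ, mul_comm]⟩)

theorem val_succAbove (h : Fin (n + 1)) (b : Fin n) :
    (h.succAbove b : ℕ) = if (b : ℕ) < h then (b : ℕ) else b + 1 := by
  simp only [Fin.succAbove, Fin.lt_def, Fin.val_castSucc]
  split_ifs <;> rfl

theorem succAbove_lt_iff (h : Fin (n + 1)) (b : Fin n) : h.succAbove b < h ↔ (b : ℕ) < h :=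
  Fin.succAbove_lt_iff_castSucc_lt h b

theorem lt_succAbove_iff (h : Fin (n + 1)) (b : Fin n) : h < h.succAbove b ↔ (h : ℕ) ≤ b :=
  Fin.lt_succAbove_iff_le_castSucc h b

theorem not_starts12_last (π : Perm (Fin (n + 1))) : ¬ Starts12 π (Fin.last n) :=
  fun ⟨j, hj, _⟩ => (Fin.le_last j).not_gt hj

theorem starts12_appendEntry_castSucc :
    Starts12 (appendEntry π h) i.castSucc ↔ Starts12 π i ∨ (π i : ℕ) < h := by
  simp [Starts12, Fin.exists_fin_succ', succAbove_lt_iff, Fin.castSucc_lt_last]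

theorem starts123Or231_appendEntry_castSucc :
    Starts123Or231 (appendEntry π h) i.castSucc ↔ Starts123Or231 π i ∨
      ∃ j, i < j ∧ π i < π j ∧ ((π j : ℕ) < h ∨ (h : ℕ) ≤ π i) := by
  simp only [Starts123Or231, appendEntry_castSucc, and_or_left, exists_or, exists_and_left,
    Fin.exists_fin_succ', appendEntry_last, Fin.succAbove_lt_succAbove_iff, lt_succAbove_iff,
    Fin.castSucc_lt_castSucc_iff, Fin.castSucc_lt_last, (Fin.castSucc_lt_last _).not_gt,
    succAbove_lt_iff, false_and, exists_false, and_false, or_false, true_and, lt_self_iff_false,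
    and_self]
  exact or_or_or_comm

theorem appendEntry_mem_avoiders_iff :
    appendEntry π h ∈ avoiders patterns (n + 1) ↔
      π ∈ avoiders patterns n ∧ activeBound π ≤ h := by
  simp only [mem_avoiders_patterns_iff, activeBound, entryBound_le_iff, Starts123Or231]
  simp only [Fin.forall_fin_succ', appendEntry_castSucc, appendEntry_last, forall_and,
    Fin.castSucc_lt_castSucc_iff, (Fin.castSucc_lt_last _).not_gt, IsEmpty.forall_iff,
    implies_true, and_true, Fin.castSucc_lt_last, forall_const, lt_self_iff_false,
    Fin.succAbove_lt_succAbove_iff, succAbove_lt_iff, forall_exists_index, and_imp]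

theorem entryBound_le_iff_of_not_last {π : Perm (Fin (n + 1))} {P : Fin (n + 1) → Prop}
    (hP : ¬ P (Fin.last n)) {c : ℕ} :
    entryBound π P ≤ c ↔ ∀ i : Fin n, P i.castSucc → (π i.castSucc : ℕ) < c := by
  simp [entryBound_le_iff, Fin.forall_fin_succ', hP]

theorem ascentBound_appendEntry (π : Perm (Fin n)) (h : Fin (n + 1)) :
    ascentBound (appendEntry π h) = if (h : ℕ) < ascentBound π then ascentBound π + 1 else h := by
  refine eq_of_forall_ge_iff fun c => ?_
  rw [ascentBound, entryBound_le_iff_of_not_last (not_starts12_last _)]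
  simp only [starts12_appendEntry_castSucc, appendEntry_castSucc, val_succAbove]
  constructor
  · intro hc
    split_ifs with hlt
    · obtain ⟨i, hi, hi_val⟩ := exists_starts12_of_ascentBound_pos (pos_of_gt hlt)
      have := hc i (.inl hi)
      rw [if_neg (by omega)] at this
      omega
    · by_contra! hch
      obtain ⟨i, hi⟩ := π.surjective ⟨c, by omega⟩
      have hi_val : (π i : ℕ) = c := by rw [hi]
      have := hc i (.inr (by omega))
      rw [if_pos (by omega)] at this
      omega
  · rintro hc i (hi | hi)
    · have := hi.lt_ascentBound
      split_ifs at hc ⊢ <;> omega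
    · split_ifs at hc ⊢ <;> omega

theorem starts12_of_starts123Or231_appendEntry
    (hi : Starts123Or231 (appendEntry π h) i.castSucc) : Starts12 π i :=
  (starts123Or231_appendEntry_castSucc.1 hi).elim (·.starts12)
    fun ⟨j, hij, hπij, _⟩ => ⟨j, hij, hπij⟩

theorem activeBound_appendEntry_le_iff {c : ℕ} :
    activeBound (appendEntry π h) ≤ c ↔
      ∀ i, Starts123Or231 (appendEntry π h) i.castSucc → (h.succAbove (π i) : ℕ) < c := by
  rw [activeBound, entryBound_le_iff_of_not_last fun hl => not_starts12_last _ hl.starts12]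
  simp only [appendEntry_castSucc]

theorem activeBound_le_activeBound_appendEntry (hle : activeBound π ≤ h) :
    activeBound π ≤ activeBound (appendEntry π h) :=
  entryBound_le_iff.2 fun i hi => by
    have := hi.lt_activeBound
    have hlt := (starts123Or231_appendEntry_castSucc (h := h).2 (.inl hi)).lt_activeBound
    rwa [appendEntry_castSucc, val_succAbove, if_pos (by omega)] at hlt

theorem activeBound_appendEntry_of_lt (hlt : (h : ℕ) < ascentBound π) :
    activeBound (appendEntry π h) = ascentBound π + 1 := by
  refine le_antisymm (activeBound_appendEntry_le_iff.2 fun i hi => ?_) ?_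
  · have := (starts12_of_starts123Or231_appendEntry hi).lt_ascentBound
    rw [val_succAbove]
    split_ifs <;> omega
  · obtain ⟨i, ⟨j, hij, hπij⟩, hi⟩ := exists_starts12_of_ascentBound_pos (pos_of_gt hlt)
    have hlt' := (starts123Or231_appendEntry_castSucc (h := h).2
      (.inr ⟨j, hij, hπij, .inr (by omega)⟩)).lt_activeBound
    rw [appendEntry_castSucc, val_succAbove, if_neg (by omega)] at hlt'
    omega

theorem activeBound_appendEntry_of_eq (heq : (h : ℕ) = ascentBound π) :
    activeBound (appendEntry π h) = activeBound π := by
  have hle : activeBound π ≤ ascentBound π := activeBound_le_ascentBound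
  refine le_antisymm (activeBound_appendEntry_le_iff.2 fun i hi => ?_)
    (activeBound_le_activeBound_appendEntry (heq ▸ hle))
  have hi_lt := (starts12_of_starts123Or231_appendEntry hi).lt_ascentBound
  rw [val_succAbove, if_pos (by omega)]
  rcases starts123Or231_appendEntry_castSucc.1 hi with hi | ⟨j, hij, hπij, hor⟩
  · exact hi.lt_activeBound
  · rcases hle.eq_or_lt with heq' | hlt
    · rwa [heq']
    obtain ⟨l, hl, hπl⟩ := exists_isTop_apply_eq_ascentBound hlt
    have hjl : j < l := (hl j).lt_of_ne (by rintro rfl; omega)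
    have hπjl : π j < π l := by rw [Fin.lt_def]; omega
    exact Starts123Or231.lt_activeBound ⟨j, l, hij, hjl, hπij, .inl hπjl⟩

theorem activeBound_appendEntry_of_gt (hgt : ascentBound π < h) :
    activeBound (appendEntry π h) = ascentBound π := by
  have hle : activeBound π ≤ ascentBound π := activeBound_le_ascentBound
  refine le_antisymm (activeBound_appendEntry_le_iff.2 fun i hi => ?_) ?_
  · have := (starts12_of_starts123Or231_appendEntry hi).lt_ascentBound
    rwa [val_succAbove, if_pos (by omega)]
  · rcases hle.eq_or_lt with heq | hlt
    · exact heq ▸ activeBound_le_activeBound_appendEntry (hle.trans hgt.le)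
    obtain ⟨i, ⟨j, hij, _⟩, hi⟩ := exists_starts12_of_ascentBound_pos (pos_of_gt hlt)
    obtain ⟨l, hl, hπl⟩ := exists_isTop_apply_eq_ascentBound hlt
    have hπil : π i < π l := by rw [Fin.lt_def]; omega
    have hlt' := (starts123Or231_appendEntry_castSucc (h := h).2
      (.inr ⟨l, hij.trans_le (hl j), hπil, .inl (by omega)⟩)).lt_activeBound
    rw [appendEntry_castSucc, val_succAbove, if_pos (by omega)] at hlt'
    omega

end AppendEntry

section AvoiderSum

variable {R : Type*} [CommSemiring R]

/-- The sum of a weight over the entries that may be appended to an avoider `π` of length `n`, where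
the weight of an avoider is evaluated at `p = ascentBound π - activeBound π` and
`d = n - ascentBound π`. -/
def childSum (w : ℕ → ℕ → R) (p d : ℕ) : R :=
  p * w 0 d + w p (d + 1) + ∑ i ∈ range d, w (i + 1) (d - i)

theorem sum_Ico_eq_childSum (w : ℕ → ℕ → R) {a b n : ℕ} (hab : a ≤ b) (hbn : b ≤ n) :
    ∑ h ∈ Ico a (n + 1), (if h < b then w 0 (n - b)
      else if h = b then w (b - a) (n - b + 1) else w (h - b) (n + 1 - h)) =
      childSum w (b - a) (n - b) := by
  have hbn' : b ≤ n + 1 := hbn.trans n.le_succ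
  rw [← sum_Ico_consecutive _ hab hbn', sum_eq_sum_Ico_succ_bot (Nat.lt_succ_of_le hbn),
    sum_Ico_eq_sum_range _ (b + 1), childSum, add_assoc]
  congr 1
  · rw [sum_congr rfl fun h hh => if_pos (mem_Ico.1 hh).2, sum_const, Nat.card_Ico, nsmul_eq_mul]
  · congr 1
    · simp
    · refine sum_congr (by congr 1; omega) fun i _ => ?_
      rw [if_neg (by omega), if_neg (by omega)]
      congr 1 <;> omega

open Classical in
variable (R) in
/-- The sum over the avoiders of length `n` of a weight depending on `ascentBound π - activeBound π`
and `n - ascentBound π`. -/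
noncomputable def avoiderSum (n : ℕ) : (ℕ → ℕ → R) →ₗ[R] R where
  toFun w := ∑ π : Perm (Fin n) with π ∈ avoiders patterns n,
    w (ascentBound π - activeBound π) (n - ascentBound π)
  map_add' _ _ := sum_add_distrib
  map_smul' _ _ := (mul_sum _ _ _).symm

theorem sum_appendEntry {n : ℕ} (π : Perm (Fin n)) (w : ℕ → ℕ → R) :
    ∑ h : Fin (n + 1) with activeBound π ≤ h.val,
      w (ascentBound (appendEntry π h) - activeBound (appendEntry π h))
        (n + 1 - ascentBound (appendEntry π h)) =
      childSum w (ascentBound π - activeBound π) (n - ascentBound π) := by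
  have hab : activeBound π ≤ ascentBound π := activeBound_le_ascentBound
  have hbn : ascentBound π ≤ n := ascentBound_le
  rw [← sum_Ico_eq_childSum w hab hbn]
  refine sum_nbij (fun h => (h : ℕ)) (fun h hh => ?_) Fin.val_injective.injOn (fun h hh => ?_)
    fun h hh => ?_
  · simp only [mem_filter_univ] at hh
    exact mem_Ico.2 ⟨hh, h.isLt⟩
  · rw [coe_Ico, Set.mem_Ico] at hh
    exact ⟨⟨h, hh.2⟩, by simpa using hh.1, rfl⟩
  · rw [mem_filter_univ] at hh
    rw [ascentBound_appendEntry]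
    rcases lt_trichotomy (h : ℕ) (ascentBound π) with hlt | heq | hgt
    · rw [activeBound_appendEntry_of_lt hlt, if_pos hlt, if_pos hlt]
      congr 1 <;> omega
    · rw [activeBound_appendEntry_of_eq heq, if_neg heq.not_lt, if_neg heq.not_lt, if_pos heq]
      congr 1 <;> omega
    · rw [activeBound_appendEntry_of_gt hgt, if_neg hgt.not_gt, if_neg hgt.not_gt, if_neg hgt.ne']

theorem avoiderSum_zero (w : ℕ → ℕ → R) : avoiderSum R 0 w = w 0 0 := by
  have hmem (π : Perm (Fin 0)) : π ∈ avoiders patterns 0 :=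
    mem_avoiders_patterns_iff.2 fun i => i.elim0
  have hascent : ascentBound (1 : Perm (Fin 0)) = 0 := Nat.le_zero.1 ascentBound_le
  simp [avoiderSum, hmem, hascent]

theorem avoiderSum_succ (n : ℕ) (w : ℕ → ℕ → R) :
    avoiderSum R (n + 1) w = avoiderSum R n (childSum w) := by
  classical
  simp only [avoiderSum, LinearMap.coe_mk, AddHom.coe_mk, ← sum_appendEntry]
  rw [sum_filter, ← (appendEntryEquiv n).sum_comp, Fintype.sum_prod_type, sum_filter]
  refine sum_congr rfl fun π _ => ?_
  simp only [appendEntryEquiv, ofBijective_apply, Function.uncurry_apply_pair,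
    appendEntry_mem_avoiders_iff, sum_filter]
  split_ifs with hπ <;> simp [hπ]

theorem avoiderSum_one (n : ℕ) : avoiderSum R n 1 = (avoiders patterns n).ncard := by
  classical
  simp [avoiderSum, Set.ncard_eq_toFinset_card']

end AvoiderSum

section GeneratingFunction

open scoped PowerSeries.WithPiTopology Topology

variable {R : Type*} [CommRing R] [TopologicalSpace R]

theorem summable_X_pow_mul (g : ℕ → R⟦X⟧) : Summable fun n => X ^ n * g n := by
  refine PowerSeries.WithPiTopology.summable_of_tendsto_order_atTop_nhds_top R ?_
  refine ENat.tendsto_nhds_top_iff_natCast_lt.2 fun m =>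
    Filter.eventually_atTop.2 ⟨m + 1, fun n hn => ?_⟩
  exact (Nat.cast_lt.2 hn).trans_le (nat_le_order _ _ fun i hi => by
    rw [coeff_X_pow_mul', if_neg hi.not_ge])

variable [IsTopologicalRing R] [T2Space R]

variable (R) in
/-- The generating function of the avoiders, weighted as in `avoiderSum`. -/
noncomputable def weightedGenFun : (ℕ → ℕ → R⟦X⟧) →ₗ[R⟦X⟧] R⟦X⟧ where
  toFun w := ∑' n, X ^ n * avoiderSum R⟦X⟧ n w
  map_add' w w' := by
    simp only [map_add, mul_add]
    exact (summable_X_pow_mul _).tsum_add (summable_X_pow_mul _)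
  map_smul' c w := by
    simp only [map_smul, smul_eq_mul, mul_left_comm _ c]
    exact (summable_X_pow_mul _).tsum_mul_left c

theorem weightedGenFun_apply (w : ℕ → ℕ → R⟦X⟧) :
    weightedGenFun R w = ∑' n, X ^ n * avoiderSum R⟦X⟧ n w :=
  rfl

theorem weightedGenFun_eq (w : ℕ → ℕ → R⟦X⟧) :
    weightedGenFun R w = w 0 0 + X * weightedGenFun R (childSum w) := by
  have hsum := summable_X_pow_mul fun n => avoiderSum R⟦X⟧ n w
  have hsum' := summable_X_pow_mul fun n => avoiderSum R⟦X⟧ n (childSum w)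
  rw [weightedGenFun_apply, hsum.tsum_eq_zero_add, weightedGenFun_apply, ← hsum'.tsum_mul_left]
  simp only [pow_zero, one_mul, avoiderSum_zero, avoiderSum_succ, pow_succ', mul_assoc]

theorem genFun_eq_weightedGenFun_one : genFun patterns = weightedGenFun ℝ 1 := by
  rw [weightedGenFun_apply, as_tsum (genFun patterns)]
  refine tsum_congr fun n => ?_
  rw [avoiderSum_one, genFun, coeff_mk, mul_comm, ← nsmul_eq_mul, X_pow_eq, ← map_nsmul, nsmul_one]

end GeneratingFunction

section KernelMethod

variable {R : Type*} [CommRing R] {k r y : R}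

/-- A weight on the avoiders for which appending an entry acts, up to an affine function of `d`, as
multiplication by a scalar. -/
def kernelWeight (k r y : R) (p d : ℕ) : R :=
  (1 + y * p) * (1 + k * r) ^ d

theorem mul_sum_kernelWeight (hk : k ^ 2 = k + 1) (hy : y * (1 + k * r) = r) (d : ℕ) :
    y * ∑ i ∈ range d, kernelWeight k r y (i + 1) (d - i) =
      (1 + k * r) ^ d - 1 - (k - 1) * (y * d) := by
  induction d with
  | zero => simp
  | succ d ih =>
    have hsum : ∑ i ∈ range (d + 1), kernelWeight k r y (i + 1) (d + 1 - i) =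
        (1 + k * r) * (∑ i ∈ range d, kernelWeight k r y (i + 1) (d - i) +
          (1 + y * (d + 1))) := by
      rw [sum_range_succ, mul_add, mul_sum]
      congr 1
      · refine sum_congr rfl fun i hi => ?_
        rw [kernelWeight, Nat.sub_add_comm (mem_range.1 hi).le, pow_succ', mul_left_comm]
        rfl
      · simp [kernelWeight, mul_comm]
    rw [hsum, Nat.cast_succ, pow_succ']
    linear_combination (1 + k * r) * ih + (k + y * (d + 1)) * hy - (d + 1) * r * y * hk

theorem mul_childSum_kernelWeight (hk : k ^ 2 = k + 1) (hy : y * (1 + k * r) = r) (p d : ℕ) :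
    y * childSum (kernelWeight k r y) p d =
      (1 + r) * kernelWeight k r y p d - 1 - (k - 1) * (y * d) := by
  have hsum := mul_sum_kernelWeight hk hy d
  rw [childSum]
  simp only [kernelWeight, Nat.cast_zero, mul_zero, add_zero, pow_succ] at hsum ⊢
  linear_combination hsum + (1 + y * p) * (1 + k * r) ^ d * hy

theorem weightedGenFun_one_eq [TopologicalSpace R] [IsTopologicalRing R] [T2Space R] {k r : R⟦X⟧}
    (hk : k ^ 2 = k + 1) (hr : X * (1 + k * r) * (1 + r) = r) :
    weightedGenFun R 1 =
      (1 + r) * (1 + (1 - k) * (X * weightedGenFun R fun _ d => (d : R⟦X⟧))) := by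
  have hy : X * (1 + r) * (1 + k * r) = r := by linear_combination hr
  set w := kernelWeight k r (X * (1 + r)) with hw
  have hchild : (X * (1 + r)) • childSum w =
      (1 + r) • w - 1 - ((k - 1) * (X * (1 + r))) • fun (_ d : ℕ) => (d : R⟦X⟧) := by
    ext1 p
    ext1 d
    simpa [mul_assoc] using mul_childSum_kernelWeight hk hy p d
  have hΦ := congr(weightedGenFun R $hchild)
  simp only [map_sub, map_smul, smul_eq_mul] at hΦ
  have hrec := weightedGenFun_eq w
  have hw0 : w 0 0 = 1 := by simp [hw, kernelWeight]
  linear_combination hΦ + (1 + r) * hrec + (1 + r) * hw0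

end KernelMethod

section Elimination

section Ring

variable {R : Type*} [CommRing R] {k x r : R}

theorem ne_zero_of_quadratic (hx : x ≠ 0) (hr : x * (1 + k * r) * (1 + r) = r) : r ≠ 0 := by
  rintro rfl
  exact hx (by simpa using hr)

theorem one_add_ne_zero_of_quadratic [Nontrivial R] (hr : x * (1 + k * r) * (1 + r) = r) :
    1 + r ≠ 0 := by
  intro h
  rw [h, mul_zero] at hr
  simp [← hr] at h

end Ring

variable {K : Type*} [Field K] {k x r t E F : K}

theorem one_add_inv_add_inv_sub_inv (hx : x ≠ 0) (hr : x * (1 + k * r) * (1 + r) = r)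
    (ht : x * (1 + (1 - k) * t) * (1 + t) = t) :
    1 + 1 / r + 1 / t - 1 / x = (1 - r * t) / (x * (1 + r) * (1 + t)) := by
  have hr0 := ne_zero_of_quadratic hx hr
  have ht0 := ne_zero_of_quadratic hx ht
  have hr1 := one_add_ne_zero_of_quadratic hr
  have ht1 := one_add_ne_zero_of_quadratic ht
  field_simp
  linear_combination t * (1 + t) * hr + r * (1 + r) * ht

theorem mul_one_sub_mul_eq_of_quadratic [CharZero K] (hx : x ≠ 0) (hk : k ^ 2 = k + 1)
    (hr : x * (1 + k * r) * (1 + r) = r) (ht : x * (1 + (1 - k) * t) * (1 + t) = t)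
    (hFr : F = (1 + r) * (1 + (1 - k) * E)) (hFt : F = (1 + t) * (1 + k * E)) :
    F * (1 - r * t) = (1 - r * t) + x * (1 + r * t) * (1 + r) * (1 + t) := by
  have helim : F * (k * (1 + t) - (1 - k) * (1 + r)) = (2 * k - 1) * (1 + r) * (1 + t) := by
    linear_combination k * (1 + t) * hFr - (1 - k) * (1 + r) * hFt
  have hdiff : r - t = r * t * (2 * k - 1 + k * r - (1 - k) * t) := by
    refine mul_left_cancel₀ hx ?_
    linear_combination r * ht - t * hr
  have hk5 : 2 * k - 1 ≠ 0 := fun h =>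
    (OfNat.ofNat_ne_zero 5 : (5 : K) ≠ 0) (by linear_combination (2 * k - 1) * h - 4 * hk)
  have hne : k * (1 + t) - (1 - k) * (1 + r) ≠ 0 := fun h => by
    rw [h, mul_zero] at helim
    exact mul_ne_zero (mul_ne_zero hk5 (one_add_ne_zero_of_quadratic hr))
      (one_add_ne_zero_of_quadratic ht) helim.symm
  refine mul_left_cancel₀ hne ?_
  linear_combination (1 - r * t) * helim - (1 - r * t) * k * (1 + t) * hr
    + (1 - r * t) * (1 - k) * (1 + r) * ht + 2 * x * (1 + r) * (1 + t) * hdiff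
    + (1 - r * t) * x * (1 + r) * (1 + t) * (r - t) * hk

theorem eq_one_add_div_of_quadratic [CharZero K] (hx : x ≠ 0) (hk : k ^ 2 = k + 1)
    (hr : x * (1 + k * r) * (1 + r) = r) (ht : x * (1 + (1 - k) * t) * (1 + t) = t)
    (hFr : F = (1 + r) * (1 + (1 - k) * E)) (hFt : F = (1 + t) * (1 + k * E)) :
    1 + 1 / r + 1 / t - 1 / x ≠ 0 ∧
      F = 1 + (1 + r * t) / (1 + 1 / r + 1 / t - 1 / x) := by
  have hclosed := mul_one_sub_mul_eq_of_quadratic hx hk hr ht hFr hFt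
  have hr1 := one_add_ne_zero_of_quadratic hr
  have ht1 := one_add_ne_zero_of_quadratic ht
  have hrt : 1 - r * t ≠ 0 := fun h => by
    have : 2 * x * (1 + r) * (1 + t) = 0 := by
      linear_combination (F - 1 + x * (1 + r) * (1 + t)) * h - hclosed
    exact mul_ne_zero (mul_ne_zero (mul_ne_zero two_ne_zero hx) hr1) ht1 this
  rw [one_add_inv_add_inv_sub_inv hx hr ht]
  refine ⟨div_ne_zero hrt (mul_ne_zero (mul_ne_zero hx hr1) ht1), ?_⟩
  field_simp
  linear_combination hclosed

end Elimination

section Branches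

variable {k s : ℝ} {r : ℝ⟦X⟧}

theorem coe_eq_branch_iff :
    (r : ℝ⸨X⸩) = branch s ↔
      4 * X * r = C (s - 1) * (1 - sqrtSeries (radicand s)) - C (1 + s) * X := by
  have := charZero_of_injective_ringHom (C_injective (R := ℝ))
  have h4X : ((4 * X : ℝ⟦X⟧) : ℝ⸨X⸩) ≠ 0 :=
    (map_ne_zero_iff _ HahnSeries.ofPowerSeries_injective).2
      (mul_ne_zero (OfNat.ofNat_ne_zero 4) X_ne_zero)
  rw [branch, eq_div_iff h4X, ← PowerSeries.coe_mul, mul_comm]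
  exact HahnSeries.ofPowerSeries_injective.eq_iff

theorem constantCoeff_radicand (s : ℝ) : constantCoeff (radicand s) = 1 := by
  simp [radicand]

theorem exists_coe_eq_branch (s : ℝ) : ∃ r : ℝ⟦X⟧, (r : ℝ⸨X⸩) = branch s := by
  obtain ⟨q, hq⟩ : X ∣ C (s - 1) * (1 - sqrtSeries (radicand s)) - C (1 + s) * X := by
    simp [X_dvd_iff, constantCoeff_sqrtSeries (constantCoeff_radicand s)]
  refine ⟨C 4⁻¹ * q, coe_eq_branch_iff.2 ?_⟩
  have h4 : (4 : ℝ⟦X⟧) * C 4⁻¹ = 1 := by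
    rw [← map_ofNat (C (R := ℝ)), ← map_mul]
    norm_num
  rw [hq]
  linear_combination X * q * h4

theorem quadratic_of_sq_eq {R : Type*} [CommRing R] [IsDomain R] [CharZero R] {x k r g : R}
    (hx : x ≠ 0) (hk : k ^ 2 = k + 1) (hg : g ^ 2 = 1 - 2 * (1 + k) * x + (2 - k) * x ^ 2)
    (hr : 4 * x * r = 2 * (k - 1) * (1 - g) - 2 * k * x) :
    x * (1 + k * r) * (1 + r) = r := by
  have hlin : (k - 1) * g = k - 1 - k * x - 2 * x * r :=
    mul_left_cancel₀ (two_ne_zero (α := R)) (by linear_combination hr)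
  refine mul_left_cancel₀ (mul_ne_zero (OfNat.ofNat_ne_zero 4) hx) ?_
  linear_combination (-k) * ((k - 1) * g + (k - 1 - k * x - 2 * x * r)) * hlin
    + k * (k - 1) ^ 2 * hg
    - (2 * k * (k - 1) * x + (k ^ 2 - 2 * k + 4) * x ^ 2 - 4 * x * r + 4 * x ^ 2 * r) * hk

theorem quadratic_of_coe_eq_branch (hk : k ^ 2 = k + 1) (hr : (r : ℝ⸨X⸩) = branch (2 * k - 1)) :
    X * (1 + C k * r) * (1 + r) = r := by
  have := charZero_of_injective_ringHom (C_injective (R := ℝ))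
  have hg := sqrtSeries_sq (constantCoeff_radicand (2 * k - 1))
  have hr4 := coe_eq_branch_iff.1 hr
  generalize sqrtSeries (radicand (2 * k - 1)) = g at hg hr4
  rw [radicand, show (3 - (2 * k - 1)) / 2 = 2 - k by ring] at hg
  simp only [map_add, map_sub, map_mul, map_one, map_ofNat] at hg hr4
  refine quadratic_of_sq_eq X_ne_zero (by rw [← map_pow, hk, map_add, map_one]) (g := g) ?_ ?_
  · linear_combination hg
  · linear_combination hr4

theorem kernel_add_one_eq_mul {κ : ℝ⟦X⟧} (hκ : κ ^ 2 = κ + 1) (r : ℝ⟦X⟧) :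
    kernel (r + 1) =
      (X * (1 + κ * r) * (1 + r) - r) * (r - X * (1 + (1 - κ) * r) * (1 + r)) := by
  rw [kernel]
  linear_combination -X ^ 2 * r ^ 2 * (1 + r) ^ 2 * hκ

end Branches

theorem genFun_patterns_eq {k r t : ℝ⟦X⟧} (hk : k ^ 2 = k + 1)
    (hr : X * (1 + k * r) * (1 + r) = r) (ht : X * (1 + (1 - k) * t) * (1 + t) = t) :
    1 + 1 / (r : ℝ⸨X⸩) + 1 / (t : ℝ⸨X⸩) - 1 / ((X : ℝ⟦X⟧) : ℝ⸨X⸩) ≠ 0 ∧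
      (genFun patterns : ℝ⸨X⸩) = 1 + (1 + (r : ℝ⸨X⸩) * (t : ℝ⸨X⸩)) /
        (1 + 1 / (r : ℝ⸨X⸩) + 1 / (t : ℝ⸨X⸩) - 1 / ((X : ℝ⟦X⟧) : ℝ⸨X⸩)) := by
  have hinj : Function.Injective (HahnSeries.ofPowerSeries ℤ ℝ) :=
    HahnSeries.ofPowerSeries_injective
  have : CharZero ℝ⸨X⸩ := charZero_of_injective_ringHom HahnSeries.C_injective
  have hX : ((X : ℝ⟦X⟧) : ℝ⸨X⸩) ≠ 0 := (map_ne_zero_iff _ hinj).2 X_ne_zero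
  have hFr := weightedGenFun_one_eq hk hr
  have hFt := weightedGenFun_one_eq (k := 1 - k) (by linear_combination hk) ht
  rw [← genFun_eq_weightedGenFun_one] at hFr hFt
  set ι := HahnSeries.ofPowerSeries ℤ ℝ
  exact eq_one_add_div_of_quadratic hX (by simpa using congr(ι $hk)) (by simpa using congr(ι $hr))
    (by simpa using congr(ι $ht)) (by simpa using congr(ι $hFr)) (by simpa using congr(ι $hFt))

end PatternAvoidance

theorem mainTheorem7 :
    ∃ r t : ℝ⟦X⟧,
      (r : ℝ⸨X⸩) = PatternAvoidance.branch (Real.sqrt 5) ∧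
      (t : ℝ⸨X⸩) = PatternAvoidance.branch (-Real.sqrt 5) ∧
      PatternAvoidance.kernel (r + 1) = 0 ∧
      PatternAvoidance.kernel (t + 1) = 0 ∧
      r ≠ 0 ∧ t ≠ 0 ∧
      1 + 1 / (r : ℝ⸨X⸩) + 1 / (t : ℝ⸨X⸩) - 1 / ((PowerSeries.X : ℝ⟦X⟧) : ℝ⸨X⸩) ≠ 0 ∧
      ((PatternAvoidance.genFun
          {PatternAvoidance.p3412, PatternAvoidance.p3421, PatternAvoidance.p2341} : ℝ⟦X⟧) :
          ℝ⸨X⸩) =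
        1 + (1 + (r : ℝ⸨X⸩) * (t : ℝ⸨X⸩)) /
          (1 + 1 / (r : ℝ⸨X⸩) + 1 / (t : ℝ⸨X⸩)
            - 1 / ((PowerSeries.X : ℝ⟦X⟧) : ℝ⸨X⸩)) := by
  open PatternAvoidance Real goldenRatio PowerSeries in
  obtain ⟨r, hr⟩ := exists_coe_eq_branch √5
  obtain ⟨t, ht⟩ := exists_coe_eq_branch (-√5)
  have hφ : (C φ : ℝ⟦X⟧) ^ 2 = C φ + 1 := by rw [← map_pow, goldenRatio_sq, map_add, map_one]
  have hr' := quadratic_of_coe_eq_branch goldenRatio_sq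
    (hr.trans (congrArg branch (by rw [goldenRatio]; ring)))
  have ht' := quadratic_of_coe_eq_branch goldenConj_sq
    (ht.trans (congrArg branch (by rw [goldenConj]; ring)))
  rw [← one_sub_goldenConj, map_sub, map_one] at ht'
  refine ⟨r, t, hr, ht, ?_, ?_, ne_zero_of_quadratic PowerSeries.X_ne_zero hr',
    ne_zero_of_quadratic PowerSeries.X_ne_zero ht', genFun_patterns_eq hφ hr' ht'⟩
  · rw [kernel_add_one_eq_mul hφ, hr', sub_self, zero_mul]
  · rw [kernel_add_one_eq_mul hφ, ht', sub_self, mul_zero]
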